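/- Let $\chi\ge 2$ be an integer and let $\mathcal B_r^{(\chi)}=(\mathcal V,\mathcal E)$ be the Bethe lattice of degree $\chi$ (the infinite tree in which every vertex has exactly $\chi$ neighbours), rooted at $r\in\mathcal V$; write $\mathrm{pa}(v)$ for the parent of $v\ne r$. Let $\alpha\in(0,1]$, $\lambda_r>0$, and $\lambda_v=\alpha^2\lambda_{\mathrm{pa}(v)}$ for $v\neq r$. Let $\boldsymbol N=(N_v)_{v\in\mathcal V}$ be $\mathbb N$-valued random variables with distribution $\mathrm{MPMRF}(\boldsymbol\lambda,\boldsymbol\alpha,\mathcal B_r^{(\chi)})$, where $\alpha_e=\alpha$ for every $e\in\mathcal E$; that is, $\boldsymbol N$ has the joint law of the family defined by $$N_r=L_r,\qquad N_v=\Big(\alpha\sqrt{\lambda_v/\lambda_{\mathrm{pa}(v)}}\Big)\circ N_{\mathrm{pa}(v)}+L_v\quad(v\ne r),$$ where $\theta\circ Y=\sum_{j=1}^{Y}I_j$ with $I_1,I_2,\dots$ Bernoulli$(\theta)$ (binomial thinning), $L_r\sim\mathrm{Poisson}(\lambda_r)$, $L_v\sim\mathrm{Poisson}(\lambda_v-\alpha\sqrt{\lambda_{\mathrm{pa}(v)}\lambda_v})$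 for $v\ne r$, and all the $L_v$ and all the Bernoulli variables used in the thinnings are mutually independent. (With the present choice of $\boldsymbol\lambda$ the thinning parameter is $\alpha^2$ and $L_v=0$ almost surely for $v\neq r$.) Let $M=\sum_{v\in\mathcal V}N_v\in\mathbb N\cup\{\infty\}$. Then: 1. If $(\chi,\alpha)\neq(2,1)$, then $M$ is finite almost surely if and only if $\chi\le 1+1/\alpha^2$. 2. In all cases, for every $x\in\mathbb N=\{0,1,2,\dots\}$, $$\Pr(M=x)=\frac{e^{-\lambda_r}\lambda_r^{x}}{x!}(1-\alpha^2)^{\chi x}+\chi e^{-\lambda_r}\sum_{j=1}^{x-1}\frac1j\,\frac{\lambda_r^{x-j}}{(x-j-1)!}\binom{\chi x-j-1}{j-1}\alpha^{2j}(1-\alpha^2)^{\chi x-2j},$$ where $0^0=1$ and an empty sum is $0$ (the mass missing from these probabilities, if any, is $\Pr(M=\infty)$). -/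

import Mathlib

open MeasureTheory ProbabilityTheory
open scoped ENNReal

universe u

/-- The Bethe lattice of degree `χ`: a tree in which every vertex has exactly `χ` neighbours.
(For `χ ≥ 2` such a tree is infinite, without leaves, and unique up to isomorphism.) -/
structure IsBetheLattice {V : Type u} (G : SimpleGraph V) (χ : ℕ) : Prop where
  isTree : G.IsTree
  degree_eq : ∀ v : V, (G.neighborSet v).ncard = χ

/-- In the tree `G` rooted at `r`, the vertex `p` is the parent of `v`. -/
def IsParent {V : Type u} (G : SimpleGraph V) (r p v : V) : Prop :=
  G.Adj p v ∧ G.dist r v = G.dist r p + 1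

/-- Binomial thinning `θ ∘ Y = ∑_{j < Y} I_j`, where the `I_j` are the Bernoulli variables
performing the selection. -/
def binomialThinning {Ω : Type*} (I : ℕ → Ω → ℕ) (Y : Ω → ℕ) (ω : Ω) : ℕ :=
  ∑ j ∈ Finset.range (Y ω), I j ω

/-- The Bernoulli distribution on `ℕ` with success probability `p` (for `p ∈ [0, 1]`). -/
noncomputable def bernoulliNat (p : ℝ) : Measure ℕ :=
  bernoulliMeasure (1 : ℕ) (0 : ℕ) (Set.projIcc (0 : ℝ) 1 zero_le_one p)

/-- Admissible mean parameters `lam` (on vertices) and dependence parameters `α` (on edges). -/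
structure IsAdmissible {V : Type u} (G : SimpleGraph V) (lam : V → ℝ) (α : Sym2 V → ℝ) :
    Prop where
  lam_pos : ∀ v, 0 < lam v
  alpha_mem : ∀ p v, G.Adj p v →
    α s(p, v) ∈ Set.Ioc 0 (min (√(lam v / lam p)) (√(lam p / lam v)))

/-- The innovations `L v` and the Bernoulli variables `I v j` used to thin towards `v`, indexed
as one family. -/
def noiseFamily {V : Type u} {Ω : Type*} (L : V → Ω → ℕ) (I : V → ℕ → Ω → ℕ) :
    V ⊕ (V × ℕ) → Ω → ℕ :=
  Sum.elim L (fun q => I q.1 q.2)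

/-- `N` is built on the probability space `(Ω, P)` by propagation from the root `r`:
`N_r = L_r ∼ Poisson(lam_r)` and, for `v` with parent `p`,
`N_v = (α_{(p,v)} √(lam_v / lam_p)) ∘ N_p + L_v` with
`L_v ∼ Poisson(lam_v - α_{(p,v)} √(lam_p lam_v))`; the innovations and all Bernoulli variables
performing the thinnings are mutually independent. -/
structure IsPropagationConstruction {V : Type u} (G : SimpleGraph V) (r : V) (lam : V → ℝ)
    (α : Sym2 V → ℝ) {Ω : Type*} [MeasurableSpace Ω] (P : Measure Ω)
    (L : V → Ω → ℕ) (I : V → ℕ → Ω → ℕ) (N : V → Ω → ℕ) : Prop where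
  measurable_innovation : ∀ v, Measurable (L v)
  measurable_bernoulli : ∀ v j, Measurable (I v j)
  indep : iIndepFun (noiseFamily L I) P
  law_root : P.map (L r) = poissonMeasure (lam r).toNNReal
  law_innovation : ∀ p v, IsParent G r p v →
    P.map (L v) = poissonMeasure (lam v - α s(p, v) * √(lam p * lam v)).toNNReal
  law_bernoulli : ∀ p v, IsParent G r p v → ∀ j,
    P.map (I v j) = bernoulliNat (α s(p, v) * √(lam v / lam p))
  root_eq : ∀ ω, N r ω = L r ω
  child_eq : ∀ p v, IsParent G r p v → ∀ ω,
    N v ω = binomialThinning (I v) (N p) ω + L v ω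

/-- `N ∼ MPMRF(lam, α, G_r)`: the parameters are admissible and the family `N`, on the probability
space `(Ω, μ)`, has the joint law of the propagation construction. -/
structure IsMPMRF {V : Type u} (G : SimpleGraph V) (r : V) (lam : V → ℝ) (α : Sym2 V → ℝ)
    {Ω : Type*} [MeasurableSpace Ω] (μ : Measure Ω) (N : V → Ω → ℕ) : Prop where
  admissible : IsAdmissible G lam α
  representation : ∃ (Ω' : Type u) (_ : MeasurableSpace Ω') (P : Measure Ω')
    (L : V → Ω' → ℕ) (I : V → ℕ → Ω' → ℕ) (N' : V → Ω' → ℕ),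
    IsProbabilityMeasure P ∧ IsPropagationConstruction G r lam α P L I N' ∧
      IdentDistrib (fun ω v => N v ω) (fun ω v => N' v ω) μ P

/-- The aggregate count `M = ∑_v N_v`, a random variable with values in `[0, ∞]`. -/
noncomputable def totalCount {V : Type u} {Ω : Type*} (N : V → Ω → ℕ) (ω : Ω) : ℝ≥0∞ :=
  ∑' v, (N v ω : ℝ≥0∞)

/-!
Along every edge the choice of `lam` makes the innovation vanish and turns the thinning parameter
into `q = a ^ 2`, so each unit of `N p` is a particle which independently produces a particle at
each child of `p` with probability `q`. The sizes `Z 0, Z 1, …` of the generations therefore form a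
Galton-Watson process: `Z 0` is Poisson, given the past `Z 1` is binomial with parameters `χ * Z 0`
and `q`, and `Z (n + 1)` is binomial with parameters `(χ - 1) * Z n` and `q` for `n ≥ 1`. This is
`IsPropagationConstruction.lintegral_generationSize_succ`: the noise attached to generation `n + 1`
is independent of the earlier generations, and once these are frozen, `Z (n + 1)` is a sum of
independent Bernoulli variables indexed by a finite set whose size depends on `Z n` only.

Finiteness. The total `∑ n, Z n` is finite exactly when some `Z n` vanishes. Conditioning on one
generation after another gives `P (Z (n + 1) = 0)` in terms of the `n`-th iterate at `0` of the
generating function `t ↦ (1 - q + q * t) ^ (χ - 1)`. If `(χ - 1) * q ≤ 1`, these iterates increase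
to the only fixed point `1`, by the strict Bernoulli inequality (`tendsto_iterate_binomialPGF`),
the exception being `χ = 2`, `q = 1`, where the generating function is the identity; if `(χ - 1) * q > 1`, they stay below some `1 - y < 1`
(`exists_iterate_binomialPGF_le`).

Law of the total. The closed form for the total progeny of `k` independent trees (`progenyLaw`)
satisfies the one-generation recursion, by Vandermonde's identity
(`sum_binomial_mul_progenyLaw_eq`). Evaluated along the process, it is a martingale; a process that
survives to generation `x + 1` has already more than `x` particles, so at that time the martingale
equals the indicator of the event that the total is `x`. Hence the probability of this event is the
expectation of the martingale at time `1`, which is a finite sum over the Poisson value of `Z 0`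
(`IsPropagationConstruction.measure_totalCount_eq`, `sum_poisson_mul_totalCountLaw`). No generating
function of the total and no Lagrange inversion is involved.
-/

/-! ### Generations of a rooted tree -/

section Tree

variable {V : Type u} {G : SimpleGraph V} {χ : ℕ} {r p p' v : V}

/-- In a rooted tree the parent is unique: a geodesic from the root to a parent of `v`, prolonged by
the edge to `v`, is the only path from the root to `v`. -/
lemma IsParent.unique (hT : G.IsTree) (h : IsParent G r p v) (h' : IsParent G r p' v) :
    p = p' := by
  have key : ∀ {q : V} (hq : IsParent G r q v),
      ∃ w : G.Walk r q, (w.concat hq.1).IsPath := by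
    intro q hq
    obtain ⟨w, hw, hlen⟩ := hT.connected.exists_path_of_dist r q
    refine ⟨w, hw.concat (fun hmem => ?_) hq.1⟩
    classical
    have h1 := G.dist_le (w.takeUntil v hmem)
    have h2 := w.length_takeUntil_le_length hmem
    have h3 := hq.2
    omega
  obtain ⟨w, hw⟩ := key h
  obtain ⟨w', hw'⟩ := key h'
  have := (hT.existsUnique_path r v).unique hw hw'
  simpa using congrArg SimpleGraph.Walk.penultimate this

lemma exists_isParent (hG : G.Connected) (hv : v ≠ r) : ∃ p, IsParent G r p v := by
  obtain ⟨w, hw⟩ := hG.exists_walk_length_eq_dist v r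
  cases w with
  | nil => exact absurd rfl hv
  | @cons _ q _ h w =>
    refine ⟨q, h.symm, ?_⟩
    have h1 := G.dist_le w
    have h2 := h.diff_dist_adj (u := r)
    simp only [SimpleGraph.Walk.length_cons] at hw
    rw [G.dist_comm (u := q) (v := r)] at h1
    rw [G.dist_comm (u := v) (v := r)] at hw
    omega

lemma IsBetheLattice.finite_neighborSet (hG : IsBetheLattice G χ) (hχ : 2 ≤ χ) (v : V) :
    (G.neighborSet v).Finite :=
  Set.finite_of_ncard_ne_zero (by rw [hG.degree_eq]; omega)

lemma IsBetheLattice.finite_children (hG : IsBetheLattice G χ) (hχ : 2 ≤ χ) (r p : V) :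
    {v | IsParent G r p v}.Finite :=
  (hG.finite_neighborSet hχ p).subset fun _ hv => hv.1

lemma IsBetheLattice.finite_sphere (hG : IsBetheLattice G χ) (hχ : 2 ≤ χ) (r : V) (n : ℕ) :
    {v | G.dist r v = n}.Finite := by
  induction n with
  | zero =>
    refine (Set.finite_singleton r).subset fun v hv => ?_
    exact (hG.isTree.connected.dist_eq_zero_iff.1 hv).symm
  | succ n ih =>
    refine (ih.biUnion fun p _ => hG.finite_children hχ r p).subset fun v hv => ?_
    have hne : v ≠ r := by
      rintro rfl
      simp at hv
    obtain ⟨p, hp⟩ := exists_isParent hG.isTree.connected hne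
    have := hp.2
    simp only [Set.mem_ofPred_eq] at hv
    exact Set.mem_biUnion (x := p) (by simp only [Set.mem_ofPred_eq]; omega) hp

lemma IsBetheLattice.countable (hG : IsBetheLattice G χ) (hχ : 2 ≤ χ) (r : V) : Countable V := by
  rw [← Set.countable_univ_iff]
  refine (Set.countable_iUnion fun n => (hG.finite_sphere hχ r n).countable).mono fun v _ => ?_
  exact Set.mem_iUnion.2 ⟨G.dist r v, rfl⟩

/-- The number of children of a vertex of the `n`-th generation of the rooted Bethe lattice of
degree `χ`: the root has `χ` of them, every other vertex spends one neighbour on its parent. -/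
def offspringCount (χ n : ℕ) : ℕ := if n = 0 then χ else χ - 1

lemma IsBetheLattice.ncard_children (hG : IsBetheLattice G χ) (r p : V) :
    {v | IsParent G r p v}.ncard = offspringCount χ (G.dist r p) := by
  have hdist : ∀ v, G.Adj p v → IsParent G r p v ∨ IsParent G r v p := fun v hv =>
    (hG.isTree.dist_eq_dist_add_one_of_adj r hv).symm.imp (fun h => ⟨hv, h⟩) fun h => ⟨hv.symm, h⟩
  unfold offspringCount
  split_ifs with h0
  · rw [← hG.degree_eq p]
    congr 1
    ext v
    refine ⟨fun h => h.1, fun h => (hdist v h).resolve_right fun h' => ?_⟩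
    have := h'.2
    omega
  · have hne : p ≠ r := by
      rintro rfl
      simp at h0
    obtain ⟨q, hq⟩ := exists_isParent hG.isTree.connected hne
    have : {v | IsParent G r p v} = G.neighborSet p \ {q} := by
      ext v
      refine ⟨fun h => ⟨h.1, ?_⟩, fun h => (hdist v h.1).resolve_right fun h' =>
        h.2 (h'.unique hG.isTree hq)⟩
      rintro rfl
      have h1 := hq.2
      have h2 := h.2
      omega
    rw [this, Set.ncard_sdiff_singleton_of_mem (show q ∈ G.neighborSet p from hq.1.symm),
      hG.degree_eq]

/-- The `n`-th generation of the rooted Bethe lattice, as a finset. -/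
noncomputable def IsBetheLattice.generation (hG : IsBetheLattice G χ) (hχ : 2 ≤ χ) (r : V) (n : ℕ) :
    Finset V :=
  (hG.finite_sphere hχ r n).toFinset

/-- The children of the vertex `p` in the rooted Bethe lattice, as a finset. -/
noncomputable def IsBetheLattice.children (hG : IsBetheLattice G χ) (hχ : 2 ≤ χ) (r p : V) :
    Finset V :=
  (hG.finite_children hχ r p).toFinset

@[simp]
lemma IsBetheLattice.mem_generation (hG : IsBetheLattice G χ) (hχ : 2 ≤ χ) {n : ℕ} :
    v ∈ hG.generation hχ r n ↔ G.dist r v = n := by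
  simp [generation]

@[simp]
lemma IsBetheLattice.mem_children (hG : IsBetheLattice G χ) (hχ : 2 ≤ χ) :
    v ∈ hG.children hχ r p ↔ IsParent G r p v := by
  simp [children]

lemma IsBetheLattice.card_children (hG : IsBetheLattice G χ) (hχ : 2 ≤ χ) (r p : V) :
    (hG.children hχ r p).card = offspringCount χ (G.dist r p) := by
  rw [← hG.ncard_children, Set.ncard_eq_toFinset_card _ (hG.finite_children hχ r p), children]

lemma IsBetheLattice.generation_zero (hG : IsBetheLattice G χ) (hχ : 2 ≤ χ) (r : V) :
    hG.generation hχ r 0 = {r} := by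
  ext v
  simp [hG.isTree.connected.dist_eq_zero_iff, eq_comm]

lemma IsBetheLattice.sum_generation_succ {M : Type*} [AddCommMonoid M] (hG : IsBetheLattice G χ)
    (hχ : 2 ≤ χ) (r : V) (n : ℕ) (f : V → M) :
    ∑ v ∈ hG.generation hχ r (n + 1), f v =
      ∑ p ∈ hG.generation hχ r n, ∑ v ∈ hG.children hχ r p, f v := by
  classical
  rw [← Finset.sum_biUnion]
  · congr 1
    ext v
    simp only [mem_generation, Finset.mem_biUnion, mem_children]
    refine ⟨fun h => ?_, fun ⟨p, hp, hv⟩ => by rw [hv.2, hp]⟩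
    have hne : v ≠ r := by
      rintro rfl
      simp at h
    obtain ⟨p, hp⟩ := exists_isParent hG.isTree.connected hne
    exact ⟨p, by have := hp.2; omega, hp⟩
  · intro p _ q _ hpq
    refine Finset.disjoint_left.2 fun v hv hv' => hpq ?_
    simp only [mem_children] at hv hv'
    exact hv.unique hG.isTree hv'

end Tree

/-! ### Binomial and Poisson laws -/

section Laws

open unitInterval

lemma binomial_conv_bernoulliMeasure (n : ℕ) (p : I) :
    (binomial n p).conv (bernoulliMeasure 1 0 p) = binomial (n + 1) p := by
  refine Measure.ext_of_singleton fun k => ?_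
  have hp0 : (0 : ℝ) ≤ p := p.2.1
  have hp1 : (0 : ℝ) ≤ 1 - p := sub_nonneg.2 p.2.2
  rw [bernoulliMeasure_def, Measure.conv_add, Measure.conv_comm, Measure.conv_comm (ν := _ • _),
    ENNReal.smul_def, ENNReal.smul_def, Measure.conv_smul_left, Measure.conv_smul_left,
    Measure.dirac_conv, Measure.dirac_conv, Measure.add_apply, Measure.smul_apply,
    Measure.smul_apply, Measure.map_apply .of_discrete .of_discrete,
    Measure.map_apply .of_discrete .of_discrete]
  have h0 : (fun x => 0 + x) ⁻¹' {k} = ({k} : Set ℕ) := by ext; simp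
  have hp : ((toNNReal p : NNReal) : ℝ≥0∞) = ENNReal.ofReal p := by
    rw [← ENNReal.ofReal_coe_nnreal]; rfl
  have hq : ((toNNReal (σ p) : NNReal) : ℝ≥0∞) = ENNReal.ofReal (1 - p) := by
    rw [← ENNReal.ofReal_coe_nnreal]; rfl
  rw [h0, hp, hq, smul_eq_mul, smul_eq_mul, binomial_singleton, binomial_singleton]
  rcases k with _ | k
  · have h1 : (fun x => 1 + x) ⁻¹' {0} = (∅ : Set ℕ) := by ext; simp
    rw [h1, measure_empty, mul_zero, zero_add, ← ENNReal.ofReal_mul hp1]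
    congr 1
    simp
    ring
  · have h1 : (fun x => 1 + x) ⁻¹' {k + 1} = ({k} : Set ℕ) := by ext; simp; omega
    rw [h1, binomial_singleton, ← ENNReal.ofReal_mul hp0, ← ENNReal.ofReal_mul hp1,
      ← ENNReal.ofReal_add (by positivity) (by positivity), Nat.choose_succ_succ,
      Nat.add_sub_add_right]
    congr 1
    push_cast
    rcases lt_or_ge k n with h | h
    · obtain ⟨d, rfl⟩ := Nat.exists_eq_add_of_lt h
      rw [show k + d + 1 - k = d + 1 by omega, show k + d + 1 - (k + 1) = d by omega]
      ring
    · rw [Nat.choose_eq_zero_of_lt (show n < k + 1 by omega)]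
      simp
      ring

/-- A sum of independent Bernoulli variables with the same parameter is binomial. -/
lemma map_sum_eq_binomial {ι Ω : Type*} [MeasurableSpace Ω] {P : Measure Ω} [IsProbabilityMeasure P]
    {B : ι → Ω → ℕ} (hB : ∀ i, Measurable (B i)) (hind : iIndepFun B P) (p : I) (T : Finset ι)
    (hlaw : ∀ i ∈ T, P.map (B i) = bernoulliMeasure 1 0 p) :
    P.map (fun ω => ∑ i ∈ T, B i ω) = binomial T.card p := by
  classical
  induction T using Finset.induction_on with
  | empty => simp [binomial_zero]
  | insert i T hi ih =>
    have h1 := (hind.indepFun_finsetSum_of_notMem hB hi).map_add_eq_map_conv_map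
      (by fun_prop) (hB i)
    rw [Finset.card_insert_of_notMem hi, ← binomial_conv_bernoulliMeasure,
      ← ih fun j hj => hlaw j (Finset.mem_insert_of_mem hj), ← hlaw i (Finset.mem_insert_self i T)]
    convert h1 using 2
    · ext ω
      simp [Finset.sum_insert hi, add_comm]
    · congr 1
      ext ω
      simp

lemma lintegral_ofReal_binomial (n : ℕ) (p : I) {f : ℕ → ℝ} (hf : ∀ k, 0 ≤ f k) :
    ∫⁻ k, ENNReal.ofReal (f k) ∂binomial n p =
      ENNReal.ofReal (∑ k ∈ Finset.range (n + 1),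
        (n.choose k * (p : ℝ) ^ k * (1 - p) ^ (n - k)) * f k) := by
  rw [← ofReal_integral_eq_lintegral_ofReal (integrable_binomial f) (ae_of_all _ hf),
    integral_binomial, Nat.range_succ_eq_Iic]
  rfl

lemma lintegral_pow_binomial (n : ℕ) (p : I) {t : ℝ} (ht : 0 ≤ t) :
    ∫⁻ k, ENNReal.ofReal (t ^ k) ∂binomial n p = ENNReal.ofReal ((1 - p + p * t) ^ n) := by
  rw [lintegral_ofReal_binomial n p fun k => pow_nonneg ht k, add_comm (1 - (p : ℝ)), add_pow]
  congr 1
  refine Finset.sum_congr rfl fun k _ => ?_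
  ring

lemma lintegral_poissonMeasure_eq_tsum (l : NNReal) (f : ℕ → ℝ≥0∞) :
    ∫⁻ k, f k ∂poissonMeasure l =
      ∑' k, ENNReal.ofReal (Real.exp (-l) * l ^ k / k.factorial) * f k := by
  rw [poissonMeasure, lintegral_sum_measure]
  simp

lemma lintegral_pow_poissonMeasure (l : NNReal) {t : ℝ} (ht : 0 ≤ t) :
    ∫⁻ k, ENNReal.ofReal (t ^ k) ∂poissonMeasure l = ENNReal.ofReal (Real.exp (l * (t - 1))) := by
  have h : HasSum (fun k : ℕ => Real.exp (-l) * ((l * t) ^ k / k.factorial))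
      (Real.exp (-l) * Real.exp (l * t)) := by
    rw [Real.exp_eq_exp_ℝ]
    exact (NormedSpace.expSeries_div_hasSum_exp ((l : ℝ) * t)).mul_left _
  rw [← Real.exp_add] at h
  rw [lintegral_poissonMeasure_eq_tsum, show (l : ℝ) * (t - 1) = -l + l * t by ring, ← h.tsum_eq,
    ENNReal.ofReal_tsum_of_nonneg (fun k => by positivity) h.summable]
  refine tsum_congr fun k => ?_
  rw [← ENNReal.ofReal_mul (by positivity), mul_pow]
  congr 1
  ring

lemma poissonMeasure_zero : poissonMeasure 0 = Measure.dirac 0 := by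
  refine Measure.ext_of_singleton fun k => ?_
  rw [poissonMeasure_singleton]
  rcases k with _ | k <;> simp

end Laws

/-! ### The law of the total progeny -/

section Progeny

/-- The probability that `k` independent Galton-Watson trees with offspring law `Binomial(c, q)`
have `m` vertices in all. The value for `m = 0` is separate because of the quotient `k / m`. -/
noncomputable def progenyLaw (c : ℕ) (q : ℝ) (k m : ℕ) : ℝ :=
  if m = 0 then (if k = 0 then 1 else 0)
  else if k ≤ m then
    k / m * (c * m).choose (m - k) * q ^ (m - k) * (1 - q) ^ (c * m - (m - k))
  else 0

lemma progenyLaw_zero_right (c : ℕ) (q : ℝ) (k : ℕ) :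
    progenyLaw c q k 0 = if k = 0 then 1 else 0 := by
  simp [progenyLaw]

lemma progenyLaw_nonneg (c : ℕ) {q : ℝ} (hq0 : 0 ≤ q) (hq1 : q ≤ 1) (k m : ℕ) :
    0 ≤ progenyLaw c q k m := by
  have : 0 ≤ 1 - q := by linarith
  unfold progenyLaw
  split_ifs <;> positivity

/-- Vandermonde's identity weighted by the summation index. -/
lemma sum_range_mul_choose_mul_choose (n N j : ℕ) :
    ∑ l ∈ Finset.range (n + 1),
        (if l ≤ j + 1 then l * n.choose l * N.choose (j + 1 - l) else 0) =
      n * (n + N - 1).choose j := by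
  rcases n with _ | n
  · simp
  have hV : (n + N).choose j = ∑ l ∈ Finset.range (j + 1), n.choose l * N.choose (j - l) := by
    rw [Nat.add_choose_eq,
      Finset.Nat.sum_antidiagonal_eq_sum_range_succ fun a b => n.choose a * N.choose b]
  rw [Finset.sum_range_succ', show n + 1 + N - 1 = n + N by omega, hV, Finset.mul_sum]
  simp only [zero_mul, ite_self, add_zero, add_le_add_iff_right, Nat.add_sub_add_right]
  have h : ∀ l, (if l ≤ j then (l + 1) * (n + 1).choose (l + 1) * N.choose (j - l) else 0) =
      if l ≤ j then (n + 1) * (n.choose l * N.choose (j - l)) else 0 := fun l => by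
    rw [← mul_assoc, Nat.add_one_mul_choose_eq, mul_comm (l + 1)]
  simp only [h]
  rw [← Finset.sum_filter]
  refine Finset.sum_subset (fun l hl => ?_) (fun l hl hl' => ?_)
  · simp only [Finset.mem_filter, Finset.mem_range] at hl ⊢
    omega
  · simp only [Finset.mem_filter, Finset.mem_range, not_and, not_le] at hl hl'
    rw [Nat.choose_eq_zero_of_lt (by omega)]
    simp

/-- Averaging the progeny law over a binomial number of initial particles. -/
lemma sum_binomial_mul_progenyLaw {c : ℕ} (hc : 1 ≤ c) (q : ℝ) (n j : ℕ) :
    ∑ l ∈ Finset.range (n + 1),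
        (n.choose l * q ^ l * (1 - q) ^ (n - l)) * progenyLaw c q l (j + 1) =
      n / (j + 1) * (n + c * (j + 1) - 1).choose j * q ^ (j + 1) *
        (1 - q) ^ (n + c * (j + 1) - (j + 1)) := by
  have hcj : j + 1 ≤ c * (j + 1) := Nat.le_mul_of_pos_left _ hc
  have key := congrArg (fun a : ℕ => (a : ℝ)) (sum_range_mul_choose_mul_choose n (c * (j + 1)) j)
  simp only [Nat.cast_sum, Nat.cast_mul] at key
  have : ∀ l ∈ Finset.range (n + 1),
      (n.choose l * q ^ l * (1 - q) ^ (n - l)) * progenyLaw c q l (j + 1) =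
      ((if l ≤ j + 1 then l * n.choose l * (c * (j + 1)).choose (j + 1 - l) else 0 : ℕ) : ℝ) *
        (q ^ (j + 1) * (1 - q) ^ (n + c * (j + 1) - (j + 1)) / (j + 1)) := by
    intro l hl
    rw [Finset.mem_range] at hl
    unfold progenyLaw
    rw [if_neg (Nat.succ_ne_zero j)]
    split_ifs with hlj
    · rw [show q ^ (j + 1) = q ^ l * q ^ (j + 1 - l) by rw [← pow_add]; congr 1; omega,
        show (1 - q) ^ (n + c * (j + 1) - (j + 1)) =
          (1 - q) ^ (n - l) * (1 - q) ^ (c * (j + 1) - (j + 1 - l)) by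
            rw [← pow_add]; congr 1; omega]
      push_cast
      ring
    · simp
  rw [Finset.sum_congr rfl this, ← Finset.sum_mul, key]
  ring

/-- One generation of the recursion for the total progeny: the law of the progeny of `k` particles
is the mixture, over the number `l` of their children, of that of `l` particles. -/
lemma sum_binomial_mul_progenyLaw_eq {c : ℕ} (hc : 1 ≤ c) (q : ℝ) {k m : ℕ} (hkm : k ≤ m) :
    ∑ l ∈ Finset.range (c * k + 1),
        ((c * k).choose l * q ^ l * (1 - q) ^ (c * k - l)) * progenyLaw c q l (m - k) =
      progenyLaw c q k m := by
  obtain ⟨j, rfl⟩ := Nat.exists_eq_add_of_le hkm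
  rw [Nat.add_sub_cancel_left]
  rcases j with _ | j
  · rw [Finset.sum_eq_single 0]
    · unfold progenyLaw
      rcases k with _ | k
      · simp
      · have : ((k : ℝ) + 1) ≠ 0 := by positivity
        simp [this]
    · intro l _ hl
      simp [progenyLaw_zero_right, hl]
    · simp
  · rw [sum_binomial_mul_progenyLaw hc]
    unfold progenyLaw
    rw [if_neg (by omega), if_pos hkm, Nat.add_sub_cancel_left, ← mul_add]
    obtain ⟨N, hN⟩ : ∃ N, c * (k + (j + 1)) = N + 1 :=
      ⟨c * (k + (j + 1)) - 1, by
        have : k + (j + 1) ≤ c * (k + (j + 1)) := Nat.le_mul_of_pos_left _ hc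
        omega⟩
    have h1 : ((N : ℝ) + 1) * N.choose j = (N + 1).choose (j + 1) * (j + 1) := by
      exact_mod_cast Nat.add_one_mul_choose_eq N j
    have h2 : (c : ℝ) * (k + (j + 1)) = N + 1 := by exact_mod_cast hN
    rw [hN, Nat.add_sub_cancel]
    have h3 : ((k : ℝ) + (j + 1)) ≠ 0 := by positivity
    have h4 : ((c * k : ℕ) : ℝ) / (j + 1) * N.choose j =
        k / ((k + (j + 1) : ℕ) : ℝ) * (N + 1).choose (j + 1) := by
      push_cast
      field_simp
      rw [← h2] at h1
      linear_combination (k : ℝ) * h1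
    rw [h4]

end Progeny

/-! ### The Markov property of the generation sizes -/

section Markov

/-- Freezing an independent variable: `E[Φ(X, Y)]` is computed by integrating out `Y` first. -/
lemma ProbabilityTheory.IndepFun.lintegral_comp_prodMk {Ω β γ : Type*} [MeasurableSpace Ω]
    [MeasurableSpace β] [MeasurableSpace γ] {P : Measure Ω} [IsProbabilityMeasure P]
    {X : Ω → β} {Y : Ω → γ} (h : IndepFun X Y P) (hX : Measurable X) (hY : Measurable Y)
    {Φ : β → γ → ℝ≥0∞} (hΦ : Measurable (Function.uncurry Φ)) :
    ∫⁻ ω, Φ (X ω) (Y ω) ∂P = ∫⁻ ω, ∫⁻ ω', Φ (X ω) (Y ω') ∂P ∂P := by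
  have := Measure.isProbabilityMeasure_map (μ := P) hX.aemeasurable
  have := Measure.isProbabilityMeasure_map (μ := P) hY.aemeasurable
  have h1 := (indepFun_iff_map_prod_eq_prod_map_map hX.aemeasurable hY.aemeasurable).1 h
  calc ∫⁻ ω, Φ (X ω) (Y ω) ∂P
      = ∫⁻ z, Function.uncurry Φ z ∂(P.map fun ω => (X ω, Y ω)) :=
        (lintegral_map hΦ (hX.prodMk hY)).symm
    _ = ∫⁻ x, ∫⁻ y, Φ x y ∂P.map Y ∂P.map X := by
        rw [h1, lintegral_prod _ hΦ.aemeasurable]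
        rfl
    _ = ∫⁻ ω, ∫⁻ y, Φ (X ω) y ∂P.map Y ∂P := lintegral_map hΦ.lintegral_prod_right' hX
    _ = _ := lintegral_congr fun ω =>
        lintegral_map (hΦ.comp measurable_prodMk_left) hY

lemma measurable_binomialThinning {Ω : Type*} [MeasurableSpace Ω] {I : ℕ → Ω → ℕ} {Y : Ω → ℕ}
    (hI : ∀ j, Measurable (I j)) (hY : Measurable Y) : Measurable (binomialThinning I Y) := by
  have h : Measurable fun z : ℕ × Ω => ∑ j ∈ Finset.range z.1, I j z.2 :=
    measurable_from_prod_countable_right fun n => by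
      dsimp only
      fun_prop
  exact h.comp (hY.prodMk measurable_id)

variable {V : Type u} {G : SimpleGraph V} {χ : ℕ} {r : V} {lam : V → ℝ} {α : Sym2 V → ℝ}
  {Ω : Type*}

/-- The number of particles in the `n`-th generation, that is, at distance `n` from the root. -/
noncomputable def generationSize (hG : IsBetheLattice G χ) (hχ : 2 ≤ χ) (r : V) (N : V → Ω → ℕ)
    (n : ℕ) (ω : Ω) : ℕ :=
  ∑ v ∈ hG.generation hχ r n, N v ω

/-- Up to generation `n`, the family `N` is measurable for every σ-algebra that makes the
innovations and the Bernoulli variables of these generations measurable. -/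
lemma measurable_of_dist_le [MeasurableSpace Ω] {L : V → Ω → ℕ} {I : V → ℕ → Ω → ℕ}
    {N : V → Ω → ℕ} (hG : G.Connected) (hroot : N r = L r)
    (hchild : ∀ p v, IsParent G r p v →
      N v = fun ω => binomialThinning (I v) (N p) ω + L v ω) (n : ℕ)
    (hL : ∀ v, Measurable (L v)) (hI : ∀ v j, G.dist r v ≤ n → Measurable (I v j))
    (v : V) (hv : G.dist r v ≤ n) : Measurable (N v) := by
  induction hd : G.dist r v generalizing v with
  | zero =>
    obtain rfl := hG.dist_eq_zero_iff.1 hd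
    rw [hroot]
    exact hL r
  | succ d ih =>
    have hne : v ≠ r := by
      rintro rfl
      simp at hd
    obtain ⟨p, hp⟩ := exists_isParent hG hne
    have hpd := hp.2
    rw [hchild p v hp]
    exact (measurable_binomialThinning (fun j => hI v j hv) (ih p (by omega) (by omega))).add (hL v)

variable [mΩ : MeasurableSpace Ω] {P : Measure Ω} {L : V → Ω → ℕ} {I : V → ℕ → Ω → ℕ}
  {N : V → Ω → ℕ}

lemma IsPropagationConstruction.measurable (hG : G.Connected)
    (h : IsPropagationConstruction G r lam α P L I N) (v : V) : Measurable (N v) :=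
  measurable_of_dist_le hG (funext h.root_eq) (fun p v hp => funext (h.child_eq p v hp))
    (G.dist r v) h.measurable_innovation
    (fun v j _ => h.measurable_bernoulli v j) v le_rfl

lemma IsPropagationConstruction.measurable_generationSize (hG : IsBetheLattice G χ) (hχ : 2 ≤ χ)
    (h : IsPropagationConstruction G r lam α P L I N) (n : ℕ) :
    Measurable (generationSize hG hχ r N n) :=
  Finset.measurable_sum _ fun v _ => h.measurable hG.isTree.connected v

lemma IsPropagationConstruction.generationSize_zero (hG : IsBetheLattice G χ) (hχ : 2 ≤ χ)
    (h : IsPropagationConstruction G r lam α P L I N) :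
    generationSize hG hχ r N 0 = L r := by
  ext ω
  simp [generationSize, hG.generation_zero, h.root_eq]

/-- The particles of generation `n + 1`, when the innovations outside the root vanish. -/
lemma IsPropagationConstruction.generationSize_succ (hG : IsBetheLattice G χ) (hχ : 2 ≤ χ)
    (h : IsPropagationConstruction G r lam α P L I N) (n : ℕ) {ω : Ω}
    (hω : ∀ v, v ≠ r → L v ω = 0) :
    generationSize hG hχ r N (n + 1) ω =
      ∑ p : hG.generation hχ r n, ∑ v ∈ hG.children hχ r p,
        ∑ j ∈ Finset.range (N p ω), I v j ω := by
  unfold generationSize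
  rw [hG.sum_generation_succ, ← Finset.sum_coe_sort]
  refine Finset.sum_congr rfl fun p _ => Finset.sum_congr rfl fun v hv => ?_
  rw [hG.mem_children] at hv
  rw [h.child_eq p v hv, hω v, add_zero]
  · rfl
  · rintro rfl
    have := hv.2
    simp at this

/-- Whatever depends only on the noise up to generation `n` and the innovations is independent of
whatever depends only on the Bernoulli variables of generation `n + 1`. The two dependences are
expressed by measurability for every σ-algebra that makes the corresponding noise measurable. -/
lemma IsPropagationConstruction.indepFun_past_noise
    (h : IsPropagationConstruction G r lam α P L I N) (n : ℕ) {β γ : Type*}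
    [MeasurableSpace β] [MeasurableSpace γ] {X : Ω → β} {Y : Ω → γ}
    (hX : ∀ m : MeasurableSpace Ω, (∀ v, Measurable[m] (L v)) →
      (∀ v j, G.dist r v ≤ n → Measurable[m] (I v j)) → Measurable[m] X)
    (hY : ∀ m : MeasurableSpace Ω, (∀ v j, G.dist r v = n + 1 → Measurable[m] (I v j)) →
      Measurable[m] Y) :
    IndepFun X Y P := by
  let S : Set (V ⊕ (V × ℕ)) := {i | ∀ v j, i = Sum.inr (v, j) → G.dist r v ≤ n}
  let T : Set (V ⊕ (V × ℕ)) := {i | ∃ v j, i = Sum.inr (v, j) ∧ G.dist r v = n + 1}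
  have hST : Disjoint S T := Set.disjoint_left.2 fun i hi ⟨v, j, hij, hv⟩ => by
    have := hi v j hij
    omega
  have hmeas : ∀ i, MeasurableSpace.comap (noiseFamily L I i) ⊤ ≤ mΩ := by
    rintro (v | ⟨v, j⟩)
    · exact (h.measurable_innovation v).comap_le
    · exact (h.measurable_bernoulli v j).comap_le
  have hind := indep_iSup_of_disjoint hmeas h.indep hST
  have hle : ∀ (U : Set (V ⊕ (V × ℕ))) i, i ∈ U →
      Measurable[⨆ i ∈ U, MeasurableSpace.comap (noiseFamily L I i) ⊤] (noiseFamily L I i) :=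
    fun U i hi => Measurable.mono (comap_measurable _)
      (le_iSup₂_of_le (f := fun i (_ : i ∈ U) => MeasurableSpace.comap (noiseFamily L I i) ⊤)
        i hi le_rfl) le_rfl
  rw [IndepFun_iff_Indep]
  refine indep_of_indep_of_le_left (indep_of_indep_of_le_right hind ?_) ?_
  · exact (hY _ fun v j hv => hle T (Sum.inr (v, j)) ⟨v, j, rfl, hv⟩).comap_le
  · refine (hX _ (fun v => hle S (Sum.inl v) ?_) fun v j hv => hle S (Sum.inr (v, j)) ?_).comap_le
    · intro w j hw
      simp at hw
    · intro w i hw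
      simp only [Sum.inr.injEq, Prod.mk.injEq] at hw
      rwa [← hw.1]

/-- The Markov property: given the first `n + 1` generations, the next one is binomial, each
particle at distance `n` being offered to every child of its vertex. -/
lemma IsPropagationConstruction.lintegral_generationSize_succ [IsProbabilityMeasure P]
    (hG : IsBetheLattice G χ) (hχ : 2 ≤ χ)
    (h : IsPropagationConstruction G r lam α P L I N) (q : unitInterval)
    (hL : ∀ᵐ ω ∂P, ∀ v, v ≠ r → L v ω = 0)
    (hI : ∀ p v, IsParent G r p v → ∀ j, P.map (I v j) = bernoulliMeasure 1 0 q)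
    (φ : ℕ → ℕ → ℝ≥0∞) (n : ℕ) :
    ∫⁻ ω, φ (∑ i ∈ Finset.range (n + 1), generationSize hG hχ r N i ω)
        (generationSize hG hχ r N (n + 1) ω) ∂P =
      ∫⁻ ω, ∫⁻ l, φ (∑ i ∈ Finset.range (n + 1), generationSize hG hχ r N i ω) l
        ∂binomial (offspringCount χ n * generationSize hG hχ r N n ω) q ∂P := by
  classical
  have hcon := hG.isTree.connected
  have hroot : N r = L r := funext h.root_eq
  have hchild : ∀ p v, IsParent G r p v → N v = fun ω => binomialThinning (I v) (N p) ω + L v ω :=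
    fun p v hp => funext (h.child_eq p v hp)
  -- `X` is the past, `Y` the fresh noise, and `T x` indexes the Bernoulli variables used when the
  -- values on generation `n` are `x`.
  let X : Ω → ℕ × (hG.generation hχ r n → ℕ) := fun ω =>
    (∑ i ∈ Finset.range (n + 1), generationSize hG hχ r N i ω, fun p => N p ω)
  let Y : Ω → (V × ℕ) → ℕ := fun ω i => if G.dist r i.1 = n + 1 then I i.1 i.2 ω else 0
  let T : (hG.generation hχ r n → ℕ) → Finset (V × ℕ) := fun x =>
    Finset.univ.biUnion fun p : hG.generation hχ r n => hG.children hχ r p ×ˢ Finset.range (x p)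
  let Φ : ℕ × (hG.generation hχ r n → ℕ) → ((V × ℕ) → ℕ) → ℝ≥0∞ := fun x y =>
    φ x.1 (∑ i ∈ T x.2, y i)
  have hdisj : ∀ x : hG.generation hχ r n → ℕ,
      Set.PairwiseDisjoint ((Finset.univ : Finset (hG.generation hχ r n)) : Set _)
      (fun p : hG.generation hχ r n => hG.children hχ r p ×ˢ Finset.range (x p)) := by
    intro x p _ p' _ hpp
    refine Finset.disjoint_left.2 fun i hi hi' => hpp (Subtype.ext ?_)
    simp only [Finset.mem_product, hG.mem_children] at hi hi'
    exact hi.1.unique hG.isTree hi'.1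
  have hT : ∀ x, ∀ i ∈ T x, ∃ p, IsParent G r p i.1 ∧ G.dist r i.1 = n + 1 := by
    intro x i hi
    simp only [T, Finset.mem_biUnion, Finset.mem_product, hG.mem_children] at hi
    obtain ⟨p, -, hp, -⟩ := hi
    exact ⟨p, hp, by rw [hp.2, (hG.mem_generation hχ).1 p.2]⟩
  have hTcard : ∀ x, (T x).card = offspringCount χ n * ∑ p, x p := by
    intro x
    rw [Finset.card_biUnion (hdisj x), Finset.mul_sum]
    refine Finset.sum_congr rfl fun p _ => ?_
    rw [Finset.card_product, hG.card_children, (hG.mem_generation hχ).1 p.2, Finset.card_range]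
  have hXm : ∀ m : MeasurableSpace Ω, (∀ v, Measurable[m] (L v)) →
      (∀ v j, G.dist r v ≤ n → Measurable[m] (I v j)) → Measurable[m] X := by
    intro m hmL hmI
    have hN := measurable_of_dist_le hcon hroot hchild n hmL hmI
    refine Measurable.prodMk (Finset.measurable_sum _ fun i hi =>
      Finset.measurable_sum _ fun v hv => hN v ?_) (measurable_pi_lambda _ fun p => hN p ?_)
    · rw [hG.mem_generation] at hv
      rw [Finset.mem_range] at hi
      omega
    · rw [(hG.mem_generation hχ).1 p.2]
  have hYm : ∀ m : MeasurableSpace Ω, (∀ v j, G.dist r v = n + 1 → Measurable[m] (I v j)) →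
      Measurable[m] Y := by
    intro m hm
    refine measurable_pi_lambda _ fun i => ?_
    by_cases hi : G.dist r i.1 = n + 1
    · simpa only [Y, if_pos hi] using hm i.1 i.2 hi
    · simpa only [Y, if_neg hi] using measurable_const
  have hΦ : Measurable (Function.uncurry Φ) :=
    measurable_from_prod_countable_right fun x =>
      (Measurable.of_discrete (f := φ x.1)).comp
        (show Measurable fun y : (V × ℕ) → ℕ => ∑ i ∈ T x.2, y i by fun_prop)
  have hinner : ∀ x, ∫⁻ ω, Φ x (Y ω) ∂P =
      ∫⁻ l, φ x.1 l ∂binomial (offspringCount χ n * ∑ p, x.2 p) q := by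
    intro x
    have hlaw := map_sum_eq_binomial (B := fun i : V × ℕ => I i.1 i.2)
      (fun i => h.measurable_bernoulli i.1 i.2)
      (h.indep.precomp (g := Sum.inr) Sum.inr_injective) q (T x.2) fun i hi => by
        obtain ⟨p, hp, -⟩ := hT _ i hi
        exact hI p i.1 hp i.2
    rw [← hTcard, ← hlaw, lintegral_map .of_discrete
      (Finset.measurable_sum _ fun i _ => h.measurable_bernoulli i.1 i.2)]
    refine lintegral_congr fun ω => ?_
    simp only [Φ, Y]
    congr 1
    refine Finset.sum_congr rfl fun i hi => ?_
    obtain ⟨p, -, hd⟩ := hT _ i hi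
    rw [if_pos hd]
  calc ∫⁻ ω, φ (∑ i ∈ Finset.range (n + 1), generationSize hG hχ r N i ω)
        (generationSize hG hχ r N (n + 1) ω) ∂P
      = ∫⁻ ω, Φ (X ω) (Y ω) ∂P := by
        refine lintegral_congr_ae (hL.mono fun ω hω => ?_)
        simp only [Φ, X]
        rw [h.generationSize_succ hG hχ n hω, Finset.sum_biUnion (hdisj _)]
        congr 1
        refine Finset.sum_congr rfl fun p _ => ?_
        rw [Finset.sum_product]
        refine Finset.sum_congr rfl fun v hv => Finset.sum_congr rfl fun j _ => ?_
        rw [hG.mem_children] at hv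
        simp only [Y]
        rw [if_pos (by rw [hv.2, (hG.mem_generation hχ).1 p.2])]
    _ = ∫⁻ ω, ∫⁻ ω', Φ (X ω) (Y ω') ∂P ∂P :=
        (h.indepFun_past_noise n hXm hYm).lintegral_comp_prodMk
          (hXm mΩ h.measurable_innovation fun v j _ => h.measurable_bernoulli v j)
          (hYm mΩ fun v j _ => h.measurable_bernoulli v j) hΦ
    _ = _ := by
        refine lintegral_congr fun ω => ?_
        rw [hinner]
        simp only [X]
        rw [Finset.sum_coe_sort (hG.generation hχ r n) fun p => N p ω]
        rfl

end Markov

/-! ### Iteration of the offspring generating function -/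

section Extinction

open Filter Topology

/-- The probability generating function of the binomial law with parameters `c` and `q`. -/
def binomialPGF (c : ℕ) (q t : ℝ) : ℝ := (1 - q + q * t) ^ c

lemma binomialPGF_mono {c : ℕ} {q s t : ℝ} (hq0 : 0 ≤ q) (hq1 : q ≤ 1) (hs : 0 ≤ s) (hst : s ≤ t) :
    binomialPGF c q s ≤ binomialPGF c q t := by
  unfold binomialPGF
  have h1 : 0 ≤ q * s := mul_nonneg hq0 hs
  have h2 : q * s ≤ q * t := mul_le_mul_of_nonneg_left hst hq0
  exact pow_le_pow_left₀ (by linarith) (by linarith) c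

lemma binomialPGF_mem_Icc (c : ℕ) {q t : ℝ} (hq0 : 0 ≤ q) (hq1 : q ≤ 1) (ht : t ∈ Set.Icc 0 1) :
    binomialPGF c q t ∈ Set.Icc 0 1 := by
  have h1 : 0 ≤ q * t := mul_nonneg hq0 ht.1
  have h2 : q * t ≤ q * 1 := mul_le_mul_of_nonneg_left ht.2 hq0
  exact ⟨pow_nonneg (by linarith) c, pow_le_one₀ (by linarith) (by linarith)⟩

lemma iterate_binomialPGF_mem_Icc (c : ℕ) {q t : ℝ} (hq0 : 0 ≤ q) (hq1 : q ≤ 1)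
    (ht : t ∈ Set.Icc 0 1) (n : ℕ) : (binomialPGF c q)^[n] t ∈ Set.Icc 0 1 := by
  induction n with
  | zero => exact ht
  | succ n ih =>
    rw [Function.iterate_succ_apply']
    exact binomialPGF_mem_Icc c hq0 hq1 ih

/-- At mean offspring at most one, the only fixed point of the generating function in `[0, 1]` is
`1`: this is the strict Bernoulli inequality, unless every particle has exactly one child. -/
lemma eq_one_of_binomialPGF_eq_self {c : ℕ} (hc : 1 ≤ c) {q t : ℝ} (hq0 : 0 < q) (hq1 : q ≤ 1)
    (hcq : c * q ≤ 1) (hne : ¬(c = 1 ∧ q = 1)) (ht : t ∈ Set.Icc 0 1)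
    (hfix : binomialPGF c q t = t) : t = 1 := by
  by_contra h1
  have hy : 0 < 1 - t := sub_pos.2 (lt_of_le_of_ne ht.2 h1)
  have hz : 0 < q * (1 - t) := mul_pos hq0 hy
  have hz1 : q * (1 - t) ≤ 1 := mul_le_one₀ hq1 hy.le (by linarith [ht.1])
  have hfix' : (1 - q * (1 - t)) ^ c = t := by
    refine Eq.trans ?_ hfix
    unfold binomialPGF
    congr 1
    ring
  obtain ⟨d, rfl⟩ := Nat.exists_eq_add_of_le' hc
  rcases Nat.eq_zero_or_pos d with rfl | hd
  · simp only [zero_add, pow_one] at hfix'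
    have : (1 - q) * (1 - t) = 0 := by linarith
    rcases mul_eq_zero.1 this with h | h
    · exact hne ⟨rfl, by linarith⟩
    · linarith
  · have hB := one_add_mul_le_pow (a := -(q * (1 - t))) (by linarith) d
    rw [← sub_eq_add_neg] at hB
    have h2 : (1 - q * (1 - t)) * (1 + d * -(q * (1 - t))) ≤ t := by
      refine le_of_le_of_eq ?_ hfix'
      rw [pow_succ']
      exact mul_le_mul_of_nonneg_left hB (by linarith)
    have h3 : (0 : ℝ) < d * (q * (1 - t)) ^ 2 := by positivity
    push_cast at hcq
    have h4 : (d + 1) * q * (1 - t) ≤ 1 * (1 - t) := mul_le_mul_of_nonneg_right hcq hy.le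
    nlinarith

lemma tendsto_iterate_binomialPGF {c : ℕ} (hc : 1 ≤ c) {q : ℝ} (hq0 : 0 < q) (hq1 : q ≤ 1)
    (hcq : c * q ≤ 1) (hne : ¬(c = 1 ∧ q = 1)) :
    Tendsto (fun n => (binomialPGF c q)^[n] 0) atTop (𝓝 1) := by
  have hmem := iterate_binomialPGF_mem_Icc c hq0.le hq1 (t := 0) (by simp)
  have hmono : Monotone fun n => (binomialPGF c q)^[n] 0 := by
    refine monotone_nat_of_le_succ fun n => ?_
    induction n with
    | zero => exact (hmem 1).1
    | succ n ih =>
      rw [Function.iterate_succ_apply', Function.iterate_succ_apply' _ (n + 1)]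
      exact binomialPGF_mono hq0.le hq1 (hmem n).1 ih
  have hlim := tendsto_atTop_ciSup hmono ⟨1, by rintro _ ⟨n, rfl⟩; exact (hmem n).2⟩
  have hcont : Continuous (binomialPGF c q) := by
    unfold binomialPGF
    fun_prop
  have hfix := isFixedPt_of_tendsto_iterate hlim hcont.continuousAt
  rwa [eq_one_of_binomialPGF_eq_self hc hq0 hq1 hcq hne
    (isClosed_Icc.mem_of_tendsto hlim (Eventually.of_forall hmem)) hfix] at hlim

/-- At mean offspring larger than one, the iterates of the generating function at `0` stay away
from `1`: they cannot cross a point that the generating function moves downwards. -/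
lemma exists_iterate_binomialPGF_le {c : ℕ} {q : ℝ} (hq0 : 0 < q) (hq1 : q ≤ 1) (hcq : 1 < c * q) :
    ∃ y : ℝ, 0 < y ∧ y < 1 ∧ ∀ n, (binomialPGF c q)^[n] 0 ≤ 1 - y := by
  -- This `y` solves `(1 - y) * (1 + c * q * y) = 1`.
  refine ⟨1 - 1 / (c * q), ?_, ?_, fun n => ?_⟩
  · rw [sub_pos, div_lt_one (by linarith)]
    exact hcq
  · have : 0 < 1 / (c * q) := by positivity
    linarith
  have hcq0 : 0 < (c : ℝ) * q := by linarith
  set y := 1 - 1 / (c * q) with hy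
  have hyeq : c * q * (1 - y) = 1 := by
    rw [hy, sub_sub_cancel, mul_one_div_cancel hcq0.ne']
  have hy0 : 0 < y := by
    rw [hy, sub_pos, div_lt_one (by linarith)]
    exact hcq
  have hy1 : y < 1 := by
    have : 0 < 1 / (c * q) := by positivity
    linarith
  have hz : 0 < q * y := mul_pos hq0 hy0
  have hz1 : q * y ≤ 1 := mul_le_one₀ hq1 hy0.le hy1.le
  have hdown : binomialPGF c q (1 - y) ≤ 1 - y := by
    have h1 : (1 - q * y) ^ c * (1 + c * (q * y)) ≤ 1 := by
      calc (1 - q * y) ^ c * (1 + c * (q * y)) ≤ (1 - q * y) ^ c * (1 + q * y) ^ c :=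
            mul_le_mul_of_nonneg_left (one_add_mul_le_pow (by linarith) c)
              (pow_nonneg (by linarith) c)
        _ = (1 - (q * y) ^ 2) ^ c := by
            rw [← mul_pow]
            congr 1
            ring
        _ ≤ 1 := pow_le_one₀ (by nlinarith) (by nlinarith)
    have h2 : (1 - y) * (1 + c * (q * y)) = 1 := by linear_combination y * hyeq
    have h3 : binomialPGF c q (1 - y) = (1 - q * y) ^ c := by
      unfold binomialPGF
      congr 1
      ring
    rw [h3]
    refine le_of_mul_le_mul_right (h1.trans h2.ge) ?_
    positivity
  induction n with
  | zero =>
    simp only [Function.iterate_zero, id]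
    linarith
  | succ n ih =>
    rw [Function.iterate_succ_apply']
    exact (binomialPGF_mono hq0.le hq1
      (iterate_binomialPGF_mem_Icc c hq0.le hq1 (by simp) n).1 ih).trans hdown

end Extinction

/-! ### Sums over generations -/

section Total

variable {V : Type u} {G : SimpleGraph V} {χ : ℕ} {Ω : Type*}

lemma totalCount_eq_tsum_generationSize (hG : IsBetheLattice G χ) (hχ : 2 ≤ χ) (r : V)
    (N : V → Ω → ℕ) (ω : Ω) :
    totalCount N ω = ∑' n, (generationSize hG hχ r N n ω : ℝ≥0∞) := by
  unfold totalCount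
  rw [← (Equiv.sigmaFiberEquiv (G.dist r)).tsum_eq, ENNReal.tsum_sigma']
  refine tsum_congr fun n => ?_
  unfold generationSize
  rw [Nat.cast_sum, ← Finset.tsum_subtype]
  refine (Equiv.tsum_eq (Equiv.subtypeEquivRight fun v => ?_)
    fun v : hG.generation hχ r n => (N v ω : ℝ≥0∞))
  exact (hG.mem_generation hχ).symm

variable {z : ℕ → ℕ}

lemma eq_zero_of_le_of_absorbing (hz : ∀ n, z n = 0 → z (n + 1) = 0) {n m : ℕ} (hn : z n = 0)
    (hnm : n ≤ m) : z m = 0 := by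
  induction m, hnm using Nat.le_induction with
  | base => exact hn
  | succ m _ ih => exact hz m ih

lemma tsum_natCast_eq_sum_of_absorbing (hz : ∀ n, z n = 0 → z (n + 1) = 0) {n : ℕ} (hn : z n = 0) :
    ∑' i, (z i : ℝ≥0∞) = ((∑ i ∈ Finset.range n, z i : ℕ) : ℝ≥0∞) := by
  rw [Nat.cast_sum]
  refine tsum_eq_sum fun i hi => ?_
  rw [Finset.mem_range, not_lt] at hi
  rw [eq_zero_of_le_of_absorbing hz hn hi, Nat.cast_zero]

lemma le_sum_range_of_absorbing (hz : ∀ n, z n = 0 → z (n + 1) = 0) {n : ℕ} (hn : z n ≠ 0) :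
    n ≤ ∑ i ∈ Finset.range n, z i := by
  calc n = ∑ i ∈ Finset.range n, 1 := by simp
    _ ≤ _ := Finset.sum_le_sum fun i hi => Nat.one_le_iff_ne_zero.2 fun h =>
        hn (eq_zero_of_le_of_absorbing hz h (Finset.mem_range.1 hi).le)

lemma tsum_natCast_lt_top_iff_of_absorbing (hz : ∀ n, z n = 0 → z (n + 1) = 0) :
    ∑' i, (z i : ℝ≥0∞) < ∞ ↔ ∃ n, z (n + 1) = 0 := by
  refine ⟨fun h => ?_, fun ⟨n, hn⟩ => ?_⟩
  · by_contra! hne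
    refine h.ne (top_le_iff.1 ?_)
    calc (⊤ : ℝ≥0∞) = ∑' _ : ℕ, 1 := by simp
      _ ≤ _ := ENNReal.tsum_le_tsum fun i => by
        have : z i ≠ 0 := fun h0 => hne i (hz i h0)
        exact_mod_cast Nat.one_le_iff_ne_zero.2 this
  · rw [tsum_natCast_eq_sum_of_absorbing hz hn]
    exact ENNReal.natCast_lt_top _

end Total

/-! ### Extinction and total progeny in the propagation construction -/

section Construction

open Filter Topology

variable {V : Type u} {G : SimpleGraph V} {χ : ℕ} {r : V} {lam : V → ℝ} {α : Sym2 V → ℝ}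
  {Ω : Type*} [MeasurableSpace Ω] {P : Measure Ω} {L : V → Ω → ℕ} {I : V → ℕ → Ω → ℕ}
  {N : V → Ω → ℕ}

lemma IsPropagationConstruction.generationSize_succ_eq_zero (hG : IsBetheLattice G χ) (hχ : 2 ≤ χ)
    (h : IsPropagationConstruction G r lam α P L I N) {ω : Ω}
    (hω : ∀ v, v ≠ r → L v ω = 0) (n : ℕ) (hn : generationSize hG hχ r N n ω = 0) :
    generationSize hG hχ r N (n + 1) ω = 0 := by
  rw [h.generationSize_succ hG hχ n hω]
  refine Finset.sum_eq_zero fun p _ => Finset.sum_eq_zero fun v _ => ?_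
  rw [Finset.sum_eq_zero_iff.1 hn p p.2]
  simp

/-- The generating function of the size of a generation, by conditioning on one generation after
another: averaging `t ^ Z (n + 1)` over the last step replaces `t` by its image under the offspring
generating function. -/
lemma IsPropagationConstruction.lintegral_pow_generationSize [IsProbabilityMeasure P]
    (hG : IsBetheLattice G χ) (hχ : 2 ≤ χ)
    (h : IsPropagationConstruction G r lam α P L I N) (q : unitInterval)
    (hL : ∀ᵐ ω ∂P, ∀ v, v ≠ r → L v ω = 0)
    (hI : ∀ p v, IsParent G r p v → ∀ j, P.map (I v j) = bernoulliMeasure 1 0 q)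
    (n : ℕ) {t : ℝ} (ht : t ∈ Set.Icc (0 : ℝ) 1) :
    ∫⁻ ω, ENNReal.ofReal (t ^ generationSize hG hχ r N (n + 1) ω) ∂P =
      ENNReal.ofReal (Real.exp ((lam r).toNNReal *
        (binomialPGF χ q ((binomialPGF (χ - 1) q)^[n] t) - 1))) := by
  have hstep : ∀ n {t : ℝ}, t ∈ Set.Icc (0 : ℝ) 1 →
      ∫⁻ ω, ENNReal.ofReal (t ^ generationSize hG hχ r N (n + 1) ω) ∂P =
      ∫⁻ ω, ENNReal.ofReal
        (binomialPGF (offspringCount χ n) q t ^ generationSize hG hχ r N n ω) ∂P := by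
    intro n t ht
    rw [h.lintegral_generationSize_succ hG hχ q hL hI (fun _ l => ENNReal.ofReal (t ^ l)) n]
    refine lintegral_congr fun ω => ?_
    rw [lintegral_pow_binomial _ _ ht.1, pow_mul]
    rfl
  induction n generalizing t with
  | zero =>
    rw [hstep 0 ht, h.generationSize_zero, Function.iterate_zero, id,
      show offspringCount χ 0 = χ from rfl, ← lintegral_pow_poissonMeasure _
        (binomialPGF_mem_Icc χ q.2.1 q.2.2 ht).1, ← h.law_root,
      lintegral_map .of_discrete (h.measurable_innovation r)]
  | succ n ih =>
    rw [hstep (n + 1) ht, show offspringCount χ (n + 1) = χ - 1 from rfl,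
      ih (binomialPGF_mem_Icc _ q.2.1 q.2.2 ht), Function.iterate_succ_apply]

lemma IsPropagationConstruction.measure_generationSize_eq_zero [IsProbabilityMeasure P]
    (hG : IsBetheLattice G χ) (hχ : 2 ≤ χ)
    (h : IsPropagationConstruction G r lam α P L I N) (q : unitInterval)
    (hL : ∀ᵐ ω ∂P, ∀ v, v ≠ r → L v ω = 0)
    (hI : ∀ p v, IsParent G r p v → ∀ j, P.map (I v j) = bernoulliMeasure 1 0 q) (n : ℕ) :
    P {ω | generationSize hG hχ r N (n + 1) ω = 0} =
      ENNReal.ofReal (Real.exp ((lam r).toNNReal *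
        (binomialPGF χ q ((binomialPGF (χ - 1) q)^[n] 0) - 1))) := by
  have hm : MeasurableSet {ω | generationSize hG hχ r N (n + 1) ω = 0} :=
    h.measurable_generationSize hG hχ (n + 1) (measurableSet_singleton 0)
  rw [← h.lintegral_pow_generationSize hG hχ q hL hI n (t := 0) (by simp),
    ← lintegral_indicator_one hm]
  refine lintegral_congr fun ω => ?_
  by_cases h0 : generationSize hG hχ r N (n + 1) ω = 0
  · simp [Set.indicator, h0]
  · simp [Set.indicator, h0]

/-- The total count is almost surely finite if and only if the mean number of children of a
particle outside the root is at most one. -/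
lemma IsPropagationConstruction.ae_totalCount_lt_top_iff [IsProbabilityMeasure P]
    (hG : IsBetheLattice G χ) (hχ : 2 ≤ χ)
    (h : IsPropagationConstruction G r lam α P L I N) (q : unitInterval)
    (hL : ∀ᵐ ω ∂P, ∀ v, v ≠ r → L v ω = 0)
    (hI : ∀ p v, IsParent G r p v → ∀ j, P.map (I v j) = bernoulliMeasure 1 0 q)
    (hlam : 0 < lam r) (hq : 0 < (q : ℝ)) (hne : ¬(χ = 2 ∧ (q : ℝ) = 1)) :
    (∀ᵐ ω ∂P, totalCount N ω < ∞) ↔ ((χ - 1 : ℕ) : ℝ) * q ≤ 1 := by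
  set E : ℕ → Set Ω := fun n => {ω | generationSize hG hχ r N (n + 1) ω = 0} with hE
  have hEm : ∀ n, MeasurableSet (E n) := fun n =>
    h.measurable_generationSize hG hχ (n + 1) (measurableSet_singleton 0)
  -- The events `E n` increase up to a null set, since extinction is absorbing almost surely.
  have hacc : ∀ n, P (Set.accumulate E n) = P (E n) := by
    intro n
    refine measure_congr ?_
    filter_upwards [hL] with ω hω
    refine propext ⟨fun hmem => ?_, fun hmem => Set.subset_accumulate hmem⟩
    obtain ⟨m, hm, hmem⟩ := Set.mem_accumulate.1 hmem
    exact eq_zero_of_le_of_absorbing (z := fun n => generationSize hG hχ r N n ω)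
      (h.generationSize_succ_eq_zero hG hχ hω) hmem (Nat.succ_le_succ hm)
  have hlim : Tendsto (fun n => P (E n)) atTop (𝓝 (P (⋃ n, E n))) := by
    simpa only [hacc] using tendsto_measure_iUnion_accumulate (μ := P) (f := E)
  have hiff : (∀ᵐ ω ∂P, totalCount N ω < ∞) ↔ P (⋃ n, E n) = 1 := by
    rw [← mem_ae_iff_prob_eq_one (MeasurableSet.iUnion hEm)]
    change _ ↔ ∀ᵐ ω ∂P, ω ∈ ⋃ n, E n
    refine eventually_congr ?_
    filter_upwards [hL] with ω hω
    rw [totalCount_eq_tsum_generationSize hG hχ r, tsum_natCast_lt_top_iff_of_absorbing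
      (h.generationSize_succ_eq_zero hG hχ hω)]
    simp only [hE, Set.mem_iUnion, Set.mem_ofPred_eq]
  have hP := h.measure_generationSize_eq_zero hG hχ q hL hI
  have hl : 0 < ((lam r).toNNReal : ℝ) := by simpa using hlam
  rw [hiff]
  refine ⟨fun h1 => ?_, fun hcq => ?_⟩
  · by_contra! hcq
    obtain ⟨y, hy0, hy1, hy⟩ := exists_iterate_binomialPGF_le hq q.2.2 hcq
    have hlt : binomialPGF χ q (1 - y) < 1 := by
      have hqy : 0 < q * y := mul_pos hq hy0
      have hqy1 : q * y ≤ 1 := mul_le_one₀ q.2.2 hy0.le hy1.le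
      unfold binomialPGF
      exact pow_lt_one₀ (by linarith) (by linarith) (by omega)
    have hle : P (⋃ n, E n) ≤ ENNReal.ofReal (Real.exp ((lam r).toNNReal *
        (binomialPGF χ q (1 - y) - 1))) := by
      refine le_of_tendsto' hlim fun n => ?_
      rw [hP n]
      refine ENNReal.ofReal_le_ofReal (Real.exp_le_exp.2 (mul_le_mul_of_nonneg_left ?_ hl.le))
      exact sub_le_sub_right (binomialPGF_mono q.2.1 q.2.2
        (iterate_binomialPGF_mem_Icc _ q.2.1 q.2.2 (by simp) n).1 (hy n)) 1
    rw [h1] at hle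
    refine hle.not_gt ?_
    rw [ENNReal.ofReal_lt_one]
    refine lt_of_lt_of_eq (Real.exp_lt_exp.2 ?_) Real.exp_zero
    exact mul_neg_of_pos_of_neg hl (sub_neg.2 hlt)
  · have ht := tendsto_iterate_binomialPGF (c := χ - 1) (by omega) hq q.2.2 hcq
      fun h => hne ⟨by omega, h.2⟩
    have hcont : Continuous fun t => ENNReal.ofReal
        (Real.exp ((lam r).toNNReal * (binomialPGF χ q t - 1))) := by
      unfold binomialPGF
      exact ENNReal.continuous_ofReal.comp (by fun_prop)
    have h2 := (hcont.tendsto 1).comp ht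
    refine tendsto_nhds_unique hlim ?_
    simp only [hE, hP]
    have hone : binomialPGF χ q 1 = 1 := by simp [binomialPGF]
    rw [hone, sub_self, mul_zero, Real.exp_zero, ENNReal.ofReal_one] at h2
    exact h2

/-- The conditional probability that the total count equals `x`, when the generations before the
present one have `A` particles in all and the present one has `k`. -/
noncomputable def totalCountLaw (c : ℕ) (q : ℝ) (x A k : ℕ) : ℝ :=
  if A ≤ x then progenyLaw c q k (x - A) else 0

lemma totalCountLaw_nonneg (c : ℕ) {q : ℝ} (hq0 : 0 ≤ q) (hq1 : q ≤ 1) (x A k : ℕ) :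
    0 ≤ totalCountLaw c q x A k := by
  unfold totalCountLaw
  split_ifs
  · exact progenyLaw_nonneg c hq0 hq1 _ _
  · exact le_rfl

lemma sum_binomial_mul_totalCountLaw {c : ℕ} (hc : 1 ≤ c) (q : ℝ) (x A k : ℕ) :
    ∑ l ∈ Finset.range (c * k + 1),
        ((c * k).choose l * q ^ l * (1 - q) ^ (c * k - l)) * totalCountLaw c q x (A + k) l =
      totalCountLaw c q x A k := by
  unfold totalCountLaw
  by_cases h1 : A + k ≤ x
  · simp only [if_pos h1, if_pos (show A ≤ x by omega)]
    rw [← sum_binomial_mul_progenyLaw_eq hc q (show k ≤ x - A by omega), Nat.sub_add_eq]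
  · simp only [if_neg h1, mul_zero, Finset.sum_const_zero]
    split_ifs
    · unfold progenyLaw
      rw [if_neg (show ¬k ≤ x - A by omega)]
      split_ifs
      · omega
      · rfl
      · rfl
    · rfl

/-- The conditional law of the total count is a martingale, and it is settled once generation
`x + 1` is known: by then the total exceeds `x` or the particles have died out. -/
lemma IsPropagationConstruction.measure_totalCount_eq [IsProbabilityMeasure P]
    (hG : IsBetheLattice G χ) (hχ : 2 ≤ χ)
    (h : IsPropagationConstruction G r lam α P L I N) (q : unitInterval)
    (hL : ∀ᵐ ω ∂P, ∀ v, v ≠ r → L v ω = 0)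
    (hI : ∀ p v, IsParent G r p v → ∀ j, P.map (I v j) = bernoulliMeasure 1 0 q) (x : ℕ) :
    P {ω | totalCount N ω = x} =
      ∫⁻ k, ENNReal.ofReal (∑ l ∈ Finset.range (χ * k + 1),
        ((χ * k).choose l * (q : ℝ) ^ l * (1 - q) ^ (χ * k - l)) *
          totalCountLaw (χ - 1) q x k l) ∂poissonMeasure (lam r).toNNReal := by
  have := hG.countable hχ r
  set Z := generationSize hG hχ r N with hZ
  have hnn := totalCountLaw_nonneg (χ - 1) q.2.1 q.2.2 x
  have hstep := fun n => h.lintegral_generationSize_succ hG hχ q hL hI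
    (fun A l => ENNReal.ofReal (totalCountLaw (χ - 1) q x A l)) n
  have hmart : ∀ n, ∫⁻ ω, ENNReal.ofReal (totalCountLaw (χ - 1) q x
      (∑ i ∈ Finset.range (n + 1), Z i ω) (Z (n + 1) ω)) ∂P =
      ∫⁻ ω, ENNReal.ofReal (totalCountLaw (χ - 1) q x
        (∑ i ∈ Finset.range 1, Z i ω) (Z 1 ω)) ∂P := by
    intro n
    induction n with
    | zero => rfl
    | succ n ih =>
      rw [hstep (n + 1), ← ih]
      refine lintegral_congr fun ω => ?_
      rw [lintegral_ofReal_binomial _ _ fun k => hnn _ _,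
        show offspringCount χ (n + 1) = χ - 1 from rfl,
        Finset.sum_range_succ (fun i => generationSize hG hχ r N i ω),
        sum_binomial_mul_totalCountLaw (by omega)]
  have hmeas : MeasurableSet {ω | totalCount N ω = x} := by
    have hm : Measurable (totalCount N) := by
      unfold totalCount
      exact Measurable.tsum fun v =>
        measurable_from_nat.comp (h.measurable hG.isTree.connected v)
    exact hm (measurableSet_singleton _)
  calc P {ω | totalCount N ω = x}
      = ∫⁻ ω, ENNReal.ofReal (totalCountLaw (χ - 1) q x
          (∑ i ∈ Finset.range (x + 1), Z i ω) (Z (x + 1) ω)) ∂P := by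
        rw [← lintegral_indicator_one hmeas]
        refine lintegral_congr_ae (hL.mono fun ω hω => ?_)
        have habs := h.generationSize_succ_eq_zero hG hχ hω
        have htot := totalCount_eq_tsum_generationSize hG hχ r N ω
        rw [← hZ] at habs htot
        unfold totalCountLaw
        -- Either the total is already known, or generations `0, …, x` already exceed `x`.
        by_cases h0 : Z (x + 1) ω = 0
        · rw [tsum_natCast_eq_sum_of_absorbing (z := fun n => Z n ω) habs h0] at htot
          simp only [Set.indicator, Set.mem_ofPred_eq, htot, Nat.cast_inj, h0, Pi.one_apply]
          unfold progenyLaw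
          split_ifs <;> first | omega | simp
        · have h1 := le_sum_range_of_absorbing (z := fun n => Z n ω) habs h0
          have h2 : totalCount N ω ≠ x := by
            intro hx
            have h3 := ENNReal.sum_le_tsum (f := fun n => (Z n ω : ℝ≥0∞)) (Finset.range (x + 1))
            rw [← htot, hx, ← Nat.cast_sum, Nat.cast_le] at h3
            omega
          simp only [Set.indicator, Set.mem_ofPred_eq, h2, if_false]
          rw [if_neg (by omega), ENNReal.ofReal_zero]
    _ = ∫⁻ ω, ENNReal.ofReal (∑ l ∈ Finset.range (χ * Z 0 ω + 1),
        ((χ * Z 0 ω).choose l * (q : ℝ) ^ l * (1 - q) ^ (χ * Z 0 ω - l)) *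
          totalCountLaw (χ - 1) q x (Z 0 ω) l) ∂P := by
        rw [hmart x, hstep 0]
        refine lintegral_congr fun ω => ?_
        rw [lintegral_ofReal_binomial _ _ fun k => hnn _ _, show offspringCount χ 0 = χ from rfl,
          Finset.sum_range_one]
    _ = _ := by
        rw [hZ, h.generationSize_zero, ← h.law_root, lintegral_map .of_discrete
          (h.measurable_innovation r)]

end Construction

/-! ### The explicit law of the total count -/

section Formula

lemma lintegral_poissonMeasure_of_eq_zero (l : NNReal) {g : ℕ → ℝ} (hg : ∀ k, 0 ≤ g k) {x : ℕ}
    (hx : ∀ k, x < k → g k = 0) :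
    ∫⁻ k, ENNReal.ofReal (g k) ∂poissonMeasure l =
      ENNReal.ofReal (∑ k ∈ Finset.range (x + 1), Real.exp (-l) * l ^ k / k.factorial * g k) := by
  rw [lintegral_poissonMeasure_eq_tsum, tsum_eq_sum (s := Finset.range (x + 1)),
    ENNReal.ofReal_sum_of_nonneg fun k _ => mul_nonneg (by positivity) (hg k)]
  · exact Finset.sum_congr rfl fun k _ => (ENNReal.ofReal_mul (by positivity)).symm
  · intro k hk
    rw [Finset.mem_range, not_lt] at hk
    rw [hx k (by omega), ENNReal.ofReal_zero, mul_zero]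

/-- The closed form of the probability that the total count is `x`, summed over the size `k` of the
root population; the summation index of the result is `j = x - k`. -/
lemma sum_poisson_mul_totalCountLaw {χ : ℕ} (hχ : 2 ≤ χ) (l q : ℝ) (x : ℕ) :
    ∑ k ∈ Finset.range (x + 1), Real.exp (-l) * l ^ k / k.factorial *
        ∑ i ∈ Finset.range (χ * k + 1),
          ((χ * k).choose i * q ^ i * (1 - q) ^ (χ * k - i)) * totalCountLaw (χ - 1) q x k i =
      Real.exp (-l) * l ^ x / (x.factorial : ℝ) * (1 - q) ^ (χ * x) +
        (χ : ℝ) * Real.exp (-l) * ∑ j ∈ Finset.Ico 1 x,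
          1 / (j : ℝ) * (l ^ (x - j) / ((x - j - 1).factorial : ℝ)) *
            ((χ * x - j - 1).choose (j - 1) : ℝ) * q ^ j * (1 - q) ^ (χ * x - 2 * j) := by
  have hself : ∑ i ∈ Finset.range (χ * x + 1),
      ((χ * x).choose i * q ^ i * (1 - q) ^ (χ * x - i)) * totalCountLaw (χ - 1) q x x i =
      (1 - q) ^ (χ * x) := by
    rw [Finset.sum_eq_single 0]
    · simp [totalCountLaw, progenyLaw]
    · intro i _ hi
      simp [totalCountLaw, progenyLaw, hi]
    · simp
  rw [Finset.sum_range_succ, hself, add_comm]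
  congr 1
  -- An empty root population contributes nothing to a positive total.
  have hzero : ∀ k ∈ Finset.range x, k ∉ Finset.Ico 1 x →
      Real.exp (-l) * l ^ k / k.factorial * ∑ i ∈ Finset.range (χ * k + 1),
        ((χ * k).choose i * q ^ i * (1 - q) ^ (χ * k - i)) * totalCountLaw (χ - 1) q x k i = 0 := by
    intro k hk hk'
    simp only [Finset.mem_range, Finset.mem_Ico, not_and, not_lt] at hk hk'
    obtain rfl : k = 0 := by omega
    have hx : x ≠ 0 := by omega
    simp [totalCountLaw, progenyLaw, hx]
  rw [← Finset.sum_subset (s₁ := Finset.Ico 1 x) (fun k hk => by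
    simp only [Finset.mem_range, Finset.mem_Ico] at hk ⊢; omega) hzero, Finset.mul_sum]
  refine Finset.sum_nbij' (fun k => x - k) (fun j => x - j) ?_ ?_ ?_ ?_ ?_
  · intro k hk
    simp only [Finset.mem_Ico] at hk ⊢
    omega
  · intro k hk
    simp only [Finset.mem_Ico] at hk ⊢
    omega
  · intro k hk
    simp only [Finset.mem_Ico] at hk
    omega
  · intro k hk
    simp only [Finset.mem_Ico] at hk
    omega
  · intro k hk
    simp only [Finset.mem_Ico] at hk
    obtain ⟨d, rfl⟩ := Nat.exists_eq_add_of_le' hk.1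
    obtain ⟨j, rfl⟩ := Nat.exists_eq_add_of_lt hk.2
    obtain ⟨c, rfl⟩ := Nat.exists_eq_add_of_le' (show 1 ≤ χ by omega)
    have hle : d + 1 ≤ d + 1 + j + 1 := by omega
    simp only [totalCountLaw, if_pos hle, Nat.add_sub_cancel]
    rw [show d + 1 + j + 1 - (d + 1) = j + 1 by omega,
      show d + 1 + j + 1 - (j + 1) = d + 1 by omega,
      sum_binomial_mul_progenyLaw (show 1 ≤ c by omega),
      show (c + 1) * (d + 1) + c * (j + 1) - 1 = (c + 1) * (d + 1 + j + 1) - (j + 1) - 1 by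
        rw [show (c + 1) * (d + 1 + j + 1) = (c + 1) * (d + 1) + c * (j + 1) + (j + 1) by ring]
        omega,
      show (c + 1) * (d + 1) + c * (j + 1) - (j + 1) =
          (c + 1) * (d + 1 + j + 1) - 2 * (j + 1) by
        rw [show (c + 1) * (d + 1 + j + 1) = (c + 1) * (d + 1) + c * (j + 1) + (j + 1) by ring]
        omega,
      Nat.add_sub_cancel, Nat.add_sub_cancel, Nat.factorial_succ]
    have h1 : (d.factorial : ℝ) ≠ 0 := by positivity
    have h2 : (d : ℝ) + 1 ≠ 0 := by positivity
    have h3 : (j : ℝ) + 1 ≠ 0 := by positivity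
    push_cast
    field_simp

end Formula

section Innovations

variable {V : Type u} {G : SimpleGraph V} {χ : ℕ} {r : V} {lam : V → ℝ} {α : Sym2 V → ℝ} {a : ℝ}
  {Ω : Type*} [MeasurableSpace Ω] {P : Measure Ω} {L : V → Ω → ℕ} {I : V → ℕ → Ω → ℕ}
  {N : V → Ω → ℕ}

/-- With `lam v = a ^ 2 * lam p` along the edges, the innovations outside the root have rate `0`. -/
lemma IsPropagationConstruction.ae_innovation_eq_zero [Countable V] (hG : G.Connected)
    (h : IsPropagationConstruction G r lam α P L I N) (ha : 0 ≤ a) (hα : ∀ e ∈ G.edgeSet, α e = a)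
    (hlam : ∀ p v, IsParent G r p v → lam v = lam p * α s(p, v) ^ 2) (hpos : ∀ v, 0 < lam v) :
    ∀ᵐ ω ∂P, ∀ v, v ≠ r → L v ω = 0 := by
  refine ae_all_iff.2 fun v => ?_
  by_cases hv : v = r
  · simp [hv]
  obtain ⟨p, hp⟩ := exists_isParent hG hv
  have hlaw := h.law_innovation p v hp
  have hα' : α s(p, v) = a := hα _ hp.1
  have hsqrt : √(lam p * lam v) = lam p * a := by
    rw [hlam p v hp, hα', show lam p * (lam p * a ^ 2) = (lam p * a) ^ 2 by ring]
    exact Real.sqrt_sq (mul_nonneg (hpos p).le ha)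
  have hzero : lam v - α s(p, v) * √(lam p * lam v) = 0 := by
    rw [hsqrt, hlam p v hp, hα']
    ring
  rw [hzero, Real.toNNReal_zero, poissonMeasure_zero] at hlaw
  have h0 : ∀ᵐ k ∂P.map (L v), k = 0 := by
    rw [hlaw, ae_dirac_eq]
    rfl
  exact (ae_of_ae_map (h.measurable_innovation v).aemeasurable h0).mono fun ω hω _ => hω

/-- With `lam v = a ^ 2 * lam p` along the edges, the thinning parameter is `a ^ 2`. -/
lemma IsPropagationConstruction.map_bernoulli
    (h : IsPropagationConstruction G r lam α P L I N) (ha : 0 ≤ a) (hα : ∀ e ∈ G.edgeSet, α e = a)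
    (hlam : ∀ p v, IsParent G r p v → lam v = lam p * α s(p, v) ^ 2) (hpos : ∀ v, 0 < lam v)
    (q : unitInterval) (hq : (q : ℝ) = a ^ 2) {p v : V} (hp : IsParent G r p v) (j : ℕ) :
    P.map (I v j) = bernoulliMeasure 1 0 q := by
  have hα' : α s(p, v) = a := hα _ hp.1
  have hsqrt : √(lam v / lam p) = a := by
    rw [hlam p v hp, hα', mul_div_cancel_left₀ _ (hpos p).ne', Real.sqrt_sq ha]
  rw [h.law_bernoulli p v hp j, hsqrt, hα', ← sq, ← hq, bernoulliNat, Set.projIcc_val]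

end Innovations

theorem mainTheorem4 {V : Type u} (G : SimpleGraph V) (χ : ℕ) (hχ : 2 ≤ χ)
    (hG : IsBetheLattice G χ) (r : V)
    (lam : V → ℝ) (α : Sym2 V → ℝ) (a : ℝ) (ha : a ∈ Set.Ioc (0 : ℝ) 1)
    (hα : ∀ e ∈ G.edgeSet, α e = a)
    (hlam : ∀ p v, IsParent G r p v → lam v = lam p * α s(p, v) ^ 2)
    {Ω : Type*} [MeasurableSpace Ω] (μ : Measure Ω) [IsProbabilityMeasure μ]
    (N : V → Ω → ℕ) (hN : IsMPMRF G r lam α μ N) :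
    (¬ (χ = 2 ∧ a = 1) →
      ((∀ᵐ ω ∂μ, totalCount N ω < ∞) ↔ (χ : ℝ) ≤ 1 + 1 / a ^ 2)) ∧
    ∀ x : ℕ, μ.real {ω | totalCount N ω = (x : ℝ≥0∞)} =
      Real.exp (-lam r) * lam r ^ x / (x.factorial : ℝ) * (1 - a ^ 2) ^ (χ * x) +
      (χ : ℝ) * Real.exp (-lam r) * ∑ j ∈ Finset.Ico 1 x,
        1 / (j : ℝ) * (lam r ^ (x - j) / ((x - j - 1).factorial : ℝ)) *
          ((χ * x - j - 1).choose (j - 1) : ℝ) *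
          a ^ (2 * j) * (1 - a ^ 2) ^ (χ * x - 2 * j) := by
  obtain ⟨⟨hpos, -⟩, Ω', _, P, L, I, N', _, h, hid⟩ := hN
  have hcount := hG.countable hχ r
  have hasq : 0 < a ^ 2 := pow_pos ha.1 2
  obtain ⟨q, hq⟩ : ∃ q : unitInterval, (q : ℝ) = a ^ 2 :=
    ⟨⟨a ^ 2, hasq.le, pow_le_one₀ ha.1.le ha.2⟩, rfl⟩
  have hL := h.ae_innovation_eq_zero hG.isTree.connected ha.1.le hα hlam hpos
  have hI : ∀ p v, IsParent G r p v → ∀ j, P.map (I v j) = bernoulliMeasure 1 0 q :=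
    fun p v hp j => h.map_bernoulli ha.1.le hα hlam hpos q hq hp j
  have hid' : IdentDistrib (totalCount N) (totalCount N') μ P := by
    have hm : Measurable fun n : V → ℕ => ∑' v, (n v : ℝ≥0∞) :=
      Measurable.tsum fun v => measurable_from_nat.comp (measurable_pi_apply v)
    exact hid.comp hm
  refine ⟨fun hne => ?_, fun x => ?_⟩
  · have hae : (∀ᵐ ω ∂μ, totalCount N ω < ∞) ↔ ∀ᵐ ω ∂P, totalCount N' ω < ∞ :=
      ⟨fun H => hid'.ae_snd measurableSet_Iio H, fun H => hid'.symm.ae_snd measurableSet_Iio H⟩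
    rw [hae, h.ae_totalCount_lt_top_iff hG hχ q hL hI (hpos r) (hq ▸ hasq) fun H => hne
      ⟨H.1, (pow_eq_one_iff_of_nonneg ha.1.le two_ne_zero).1 (hq ▸ H.2)⟩, hq,
      Nat.cast_sub (by omega), Nat.cast_one, ← le_div_iff₀ hasq, sub_le_iff_le_add']
  · have hx : μ.real {ω | totalCount N ω = (x : ℝ≥0∞)} =
        P.real {ω | totalCount N' ω = (x : ℝ≥0∞)} :=
      congrArg ENNReal.toReal (hid'.measure_mem_eq (measurableSet_singleton (x : ℝ≥0∞)))
    have hq1 : 0 ≤ 1 - (q : ℝ) := sub_nonneg.2 q.2.2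
    have hq0 : 0 ≤ (q : ℝ) := q.2.1
    have hnn : ∀ k, 0 ≤ ∑ i ∈ Finset.range (χ * k + 1),
        ((χ * k).choose i * (q : ℝ) ^ i * (1 - q) ^ (χ * k - i)) *
          totalCountLaw (χ - 1) q x k i := fun k => Finset.sum_nonneg fun i _ =>
      mul_nonneg (by positivity) (totalCountLaw_nonneg _ hq0 q.2.2 _ _ _)
    rw [hx, measureReal_def, h.measure_totalCount_eq hG hχ q hL hI x,
      lintegral_poissonMeasure_of_eq_zero _ hnn (x := x) fun k hk => Finset.sum_eq_zero
        fun i _ => by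
          rw [totalCountLaw, if_neg (by omega), mul_zero],
      ENNReal.toReal_ofReal (Finset.sum_nonneg fun k _ => mul_nonneg (by positivity) (hnn k)),
      sum_poisson_mul_totalCountLaw hχ, hq, Real.coe_toNNReal _ (hpos r).le]
    simp only [pow_mul]
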